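/- Consider an open network of $J$ infinite server queues. Batches arrive at the points $T_1<T_2<\dots$ of a homogeneous Poisson process on $[0,\infty)$ of rate $\lambda>0$, and the network is empty before the first arrival. At time $T_i$, $\Sigma_{ij}$ customers enter at queue $j$ ($j=1,\dots,J$), where the vectors $(\Sigma_{i1},\dots,\Sigma_{iJ})$, $i\ge 1$, are independent copies of a random vector $\mathbf S=(S_1,\dots,S_J)$ with non-negative integer components. The position of the $\ell$-th customer of the $i$-th batch who enters at queue $j$ is described by a (measurable) stochastic process $X^j_{i,\ell}(t)$, $t\ge 0$: $X^j_{i,\ell}(t)=k$ if the customer is in queue $k$ at time $T_i+t$, and this has probability $P(X^j_{i,\ell}(t)=k)=q^j_k(t)$; with the remaining probability the customer is outside the network. The arrival times, the batch vectors and all the processes $X^j_{i,\ell}$ are mutually independent. Let $\mathbf N(t)=(N_1(t),\dots,N_J(t))$ be the numbers of customers in the queues at time $t$, and call the network ergodic if $\mathbf N(t)$ converges in distribution, as $t\to\infty$, to a proper probability distribution on $\mathbb Z_{\ge 0}^J$. Let $Q_j(t)=\sum_{k=1}^J q^j_k(t)$ be the probability that a customer who entered at queue $j$ is in the network a time $t$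 after arrival. Suppose that there exist $\alpha>1$ and $t_0>0$ such that $Q_j(t)\le t^{-\alpha}$ for all $j\in\{1,\dots,J\}$ and all $t\ge t_0$. Then the network is ergodic if $\mathbb E\big[(S_1+\dots+S_J)^{1/\alpha}\big]<\infty$. -/

import Mathlib

open MeasureTheory ProbabilityTheory Filter Topology
open scoped NNReal ENNReal

namespace BatchQueue

/-- The gaps `T₀, T₁ - T₀, T₂ - T₁, …` between successive points of a point process on `[0, ∞)`
(the first point is `T 0`). -/
def interarrival {Ω : Type*} (T : ℕ → Ω → ℝ) : ℕ → Ω → ℝ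
  | 0 => T 0
  | i + 1 => fun ω => T (i + 1) ω - T i ω

/-- The position of a customer is `some k` while the customer is in queue `k`, and `none` while
the customer is outside the network. This is the σ-algebra generated by a position process. -/
@[reducible]
def pathSigma {Ω : Type*} {J : ℕ} (Y : ℝ≥0 → Ω → Option (Fin J)) : MeasurableSpace Ω :=
  ⨆ s, MeasurableSpace.comap (Y s) ⊤

/-- The mutually independent sources of randomness of the network: the `i`-th gap between
arrivals, the `i`-th batch vector, and the route of the `ℓ`-th customer of batch `i` that enters
at queue `j`. -/
inductive Source (J : ℕ) : Type
  | gap (i : ℕ)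
  | batch (i : ℕ)
  | route (i : ℕ) (j : Fin J) (ℓ : ℕ)

/-- The σ-algebra generated by each source of randomness. -/
@[reducible]
def sourceSigma {Ω : Type*} {J : ℕ} (T : ℕ → Ω → ℝ) (B : ℕ → Ω → Fin J → ℕ)
    (X : ℕ → Fin J → ℕ → ℝ≥0 → Ω → Option (Fin J)) : Source J → MeasurableSpace Ω
  | .gap i => MeasurableSpace.comap (interarrival T i) inferInstance
  | .batch i => MeasurableSpace.comap (B i) inferInstance
  | .route i j ℓ => pathSigma (X i j ℓ)

/-- An open network of `J` infinite server queues with multivariate batch arrivals.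

* The batches arrive at the points `T 0 < T 1 < …` of a homogeneous Poisson process of rate `lam`
  (the gaps are independent and exponentially distributed with parameter `lam`).
* At time `T i`, `B i ω j` customers enter at queue `j`; the vectors `B i` are independent with
  common law `ν` on `ℕ^J`.
* `X i j ℓ s` is the position, a time `s` after the arrival `T i`, of the `ℓ`-th customer of the
  `i`-th batch who enters at queue `j`. It is in queue `k` with probability `q j k s`.
* Arrival times, batch vectors and all routes are mutually independent.

Each route is a measurable process (jointly in time and in the randomness of the route itself), as
is every process with right-continuous paths; this makes the position of a customer at an
independent random time a random variable with the expected law. -/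
structure IsNetwork {Ω : Type*} [MeasurableSpace Ω] (P : Measure Ω) {J : ℕ} (lam : ℝ)
    (ν : Measure (Fin J → ℕ)) (q : Fin J → Fin J → ℝ≥0 → ℝ)
    (T : ℕ → Ω → ℝ) (B : ℕ → Ω → Fin J → ℕ)
    (X : ℕ → Fin J → ℕ → ℝ≥0 → Ω → Option (Fin J)) : Prop where
  rate_pos : 0 < lam
  measurable_arrival : ∀ i, Measurable (T i)
  measurable_batch : ∀ i, Measurable (B i)
  measurable_position : ∀ i j ℓ s, Measurable[_, ⊤] (X i j ℓ s)
  measurable_route : ∀ i j ℓ,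
    Measurable[MeasurableSpace.prod inferInstance (pathSigma (X i j ℓ)), ⊤]
      (fun p : ℝ≥0 × Ω => X i j ℓ p.1 p.2)
  law_interarrival : ∀ i, P.map (interarrival T i) = expMeasure lam
  law_batch : ∀ i, P.map (B i) = ν
  law_position : ∀ i j ℓ s k, P.real {ω | X i j ℓ s ω = some k} = q j k s
  independent : iIndep (sourceSigma T B X) P

/-- `Q_j(s) = ∑_k q^j_k(s)`, the probability that a customer who entered at queue `j` is still in
the network a time `s` after arrival. -/
def occupancyTail {J : ℕ} (q : Fin J → Fin J → ℝ≥0 → ℝ) (j : Fin J) (s : ℝ≥0) : ℝ :=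
  ∑ k, q j k s

/-- `N_k(t)`, the number of customers in queue `k` at time `t`: the customers `(i, j, ℓ)` with
`ℓ < B i ω j` who arrived at a time `T i ≤ t` and whose position a time `t - T i` after arrival is
`k`. The network is empty before the first arrival. -/
noncomputable def occupancy {Ω : Type*} {J : ℕ} (T : ℕ → Ω → ℝ) (B : ℕ → Ω → Fin J → ℕ)
    (X : ℕ → Fin J → ℕ → ℝ≥0 → Ω → Option (Fin J)) (t : ℝ≥0) (ω : Ω) (k : Fin J) : ℕ∞ :=
  Set.encard {c : ℕ × Fin J × ℕ | T c.1 ω ≤ t ∧ c.2.2 < B c.1 ω c.2.1 ∧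
    X c.1 c.2.1 c.2.2 (Real.toNNReal (t - T c.1 ω)) ω = some k}

/-- The network is ergodic: as `t → ∞`, the occupancy vector `N(t) = (N_1(t), …, N_J(t))` converges
in distribution to a proper (not defective) probability distribution on `ℕ^J`. -/
def IsErgodic {Ω : Type*} [MeasurableSpace Ω] (P : Measure Ω) {J : ℕ}
    (T : ℕ → Ω → ℝ) (B : ℕ → Ω → Fin J → ℕ)
    (X : ℕ → Fin J → ℕ → ℝ≥0 → Ω → Option (Fin J)) : Prop :=
  ∃ p : PMF (Fin J → ℕ), ∀ n : Fin J → ℕ,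
    Tendsto (fun t : ℝ≥0 => P {ω | ∀ k, occupancy T B X t ω k = (n k : ℕ∞)}) atTop (𝓝 (p n))

end BatchQueue

/-! Time reversal replaces convergence in law by almost sure convergence. Given the number `n` of
arrivals in `[0, t]`, the arrival configuration has the same law after the reflection `s ↦ t - s`.
The batches are exchangeable, since their data are i.i.d. and independent of the arrivals. Hence,
for each fixed `t`, `N(t)` has the law of the vector obtained by observing every batch with `T i ≤
t` at age `T i` instead of `t - T i` (`measure_occupancy_eq`). This vector is nondecreasing in `t`
for each outcome, and its limit `L` is the sum over all batches observed at age `T i`.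

It remains to see that `L` is finite almost surely, which follows from Borel–Cantelli
(`ae_eventually_contribution_eq_zero`). A Chernoff bound gives `T i > c * i` outside events of
summable probability (`exists_tsum_arrival_le_ne_top`). By the tail hypothesis and a union bound
over customers, a batch of size `y` older than `c * i ≥ t₀` contributes with probability at most
`min 1 (y * (c * i) ^ (-α))` (`measure_contribution_ne_zero_le`). Summed over `i`, this is at most a
constant times `y ^ (1 / α) + 1` (`tsum_min_one_rpow_le`), and the moment hypothesis makes the
expectation finite. So almost surely only finitely many batches contribute, the reversed vector
equals `L` from some time on, and the law of `L` is the proper limit. -/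

namespace BatchQueue

/-! ### Reversal of Poisson points, in gap coordinates -/

section GapReversal

/-- Integration against a product of measures with densities. -/
lemma lintegral_pi_withDensity {f : ℝ → ℝ≥0∞} (hf : Measurable f)
    [SigmaFinite (volume.withDensity f)] (n : ℕ) {F : (Fin n → ℝ) → ℝ≥0∞} (hF : Measurable F) :
    ∫⁻ x, F x ∂(Measure.pi fun _ : Fin n => (volume : Measure ℝ).withDensity f)
      = ∫⁻ x, (∏ i, f (x i)) * F x := by
  induction n with
  | zero =>
    rw [volume_pi, Measure.pi_of_empty, Measure.pi_of_empty]
    simp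
  | succ n ih =>
    have hF' : Measurable fun p : ℝ × (Fin n → ℝ) =>
        F ((MeasurableEquiv.piFinSuccAbove (fun _ : Fin (n + 1) => ℝ) 0).symm p) :=
      hF.comp (MeasurableEquiv.measurable _)
    have hF1 := hF'.lintegral_prod_right'
      (ν := Measure.pi fun _ : Fin n => (volume : Measure ℝ).withDensity f)
    rw [← (measurePreserving_piFinSuccAbove
        (fun _ : Fin (n + 1) => (volume : Measure ℝ).withDensity f) 0).symm.lintegral_comp hF,
      ← (volume_preserving_piFinSuccAbove (fun _ : Fin (n + 1) => ℝ) 0).symm.lintegral_comp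
        (by fun_prop), Measure.volume_eq_prod]
    rw [lintegral_prod _ hF'.aemeasurable, lintegral_prod _ (by fun_prop)]
    rw [lintegral_withDensity_eq_lintegral_mul _ hf hF1]
    refine lintegral_congr fun a => ?_
    have hFa : Measurable fun y : Fin n → ℝ =>
        F ((MeasurableEquiv.piFinSuccAbove (fun _ : Fin (n + 1) => ℝ) 0).symm (a, y)) :=
      hF'.comp measurable_prodMk_left
    rw [Pi.mul_apply, ih hFa, ← lintegral_const_mul _ (by fun_prop)]
    refine lintegral_congr fun y => ?_
    simp [MeasurableEquiv.piFinSuccAbove_symm_apply, Fin.prod_univ_succ, mul_assoc]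

/-- The points of a process with gaps `x`. -/
def epoch {n : ℕ} (x : Fin n → ℝ) (i : Fin n) : ℝ := ∑ j ∈ Finset.Iic i, x j

/-- The gap vectors of length `n` all of whose points lie in `[0, t]`. -/
def gapSimplex (n : ℕ) (t : ℝ) : Set (Fin n → ℝ) := {x | (∀ i, 0 ≤ x i) ∧ ∑ i, x i ≤ t}

lemma measurable_epoch {n : ℕ} (i : Fin n) : Measurable fun x : Fin n → ℝ => epoch x i := by
  unfold epoch; fun_prop

lemma measurableSet_gapSimplex (n : ℕ) (t : ℝ) : MeasurableSet (gapSimplex n t) := by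
  unfold gapSimplex
  measurability

lemma epoch_zero {n : ℕ} (x : Fin (n + 1) → ℝ) : epoch x 0 = x 0 := by
  have : Finset.Iic (0 : Fin (n + 1)) = {0} := by ext i; simp
  simp [epoch, this]

lemma epoch_succ {n : ℕ} (x : Fin (n + 1) → ℝ) (i : Fin n) :
    epoch x i.succ = epoch x i.castSucc + x i.succ := by
  have : Finset.Iic i.succ = insert i.succ (Finset.Iic i.castSucc) := by
    ext j
    simp only [Finset.mem_Iic, Finset.mem_insert, Fin.le_def, Fin.ext_iff, Fin.val_succ,
      Fin.val_castSucc]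
    omega
  rw [epoch, this, Finset.sum_insert (by simp [Fin.le_def]), add_comm, epoch]

lemma epoch_last {n : ℕ} (x : Fin (n + 1) → ℝ) : epoch x (Fin.last n) = ∑ i, x i := by
  have : Finset.Iic (Fin.last n) = Finset.univ := by ext j; simp [Fin.le_last]
  rw [epoch, this]

/-- The linear part of the time reversal of gap vectors. -/
def gapReversalLinear (n : ℕ) : (Fin (n + 1) → ℝ) →ₗ[ℝ] (Fin (n + 1) → ℝ) where
  toFun x := Fin.cons (-∑ i, x i) fun i : Fin n => x i.rev.succ
  map_add' x y := by
    ext i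
    refine Fin.cases ?_ (fun i => ?_) i
    · simp [Finset.sum_add_distrib]; ring
    · simp
  map_smul' c x := by
    ext i
    refine Fin.cases ?_ (fun i => ?_) i
    · simp [Finset.mul_sum]
    · simp

lemma gapReversalLinear_zero {n : ℕ} (x : Fin (n + 1) → ℝ) :
    gapReversalLinear n x 0 = -∑ i, x i := rfl

lemma gapReversalLinear_succ {n : ℕ} (x : Fin (n + 1) → ℝ) (i : Fin n) :
    gapReversalLinear n x i.succ = x i.rev.succ := rfl

lemma sum_rev_succ {n : ℕ} (x : Fin (n + 1) → ℝ) :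
    ∑ i : Fin n, x i.rev.succ = ∑ i : Fin n, x i.succ :=
  Equiv.sum_comp Fin.revPerm fun i : Fin n => x i.succ

lemma gapReversalLinear_involutive (n : ℕ) :
    gapReversalLinear n ∘ₗ gapReversalLinear n = LinearMap.id := by
  refine LinearMap.ext fun x => funext fun i => ?_
  refine Fin.cases ?_ (fun i => ?_) i
  · simp only [LinearMap.comp_apply, gapReversalLinear_zero, LinearMap.id_apply]
    rw [Fin.sum_univ_succ]
    simp only [gapReversalLinear_zero, gapReversalLinear_succ, sum_rev_succ]
    rw [Fin.sum_univ_succ x]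
    ring
  · simp [LinearMap.comp_apply, gapReversalLinear_succ]

/-- An involution has determinant of square one, so no matrix has to be expanded. -/
lemma abs_det_gapReversalLinear (n : ℕ) : |LinearMap.det (gapReversalLinear n)| = 1 := by
  have h := congrArg LinearMap.det (gapReversalLinear_involutive n)
  rw [LinearMap.det_comp, LinearMap.det_id] at h
  rw [← abs_one, ← sq_eq_sq_iff_abs_eq_abs]
  linarith

/-- Time reversal on `[0, t]`, in terms of gaps. -/
def gapReversal (n : ℕ) (t : ℝ) (x : Fin (n + 1) → ℝ) : Fin (n + 1) → ℝ :=
  Pi.single 0 t + gapReversalLinear n x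

lemma gapReversal_zero {n : ℕ} (t : ℝ) (x : Fin (n + 1) → ℝ) :
    gapReversal n t x 0 = t - ∑ i, x i := by
  simp [gapReversal, gapReversalLinear_zero, sub_eq_add_neg]

lemma gapReversal_succ {n : ℕ} (t : ℝ) (x : Fin (n + 1) → ℝ) (i : Fin n) :
    gapReversal n t x i.succ = x i.rev.succ := by
  simp [gapReversal, gapReversalLinear_succ]

lemma sum_gapReversal {n : ℕ} (t : ℝ) (x : Fin (n + 1) → ℝ) :
    ∑ i, gapReversal n t x i = t - x 0 := by
  rw [Fin.sum_univ_succ]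
  simp only [gapReversal_zero, gapReversal_succ, sum_rev_succ]
  rw [Fin.sum_univ_succ x]
  ring

/-- The inner gaps are listed backwards, and the first gap becomes the time left between the last
point and `t`. The points are therefore reflected and, to stay increasing, renumbered by `Fin.rev`.
-/
lemma epoch_gapReversal {n : ℕ} (t : ℝ) (x : Fin (n + 1) → ℝ) (i : Fin (n + 1)) :
    epoch (gapReversal n t x) i = t - epoch x i.rev := by
  induction i using Fin.induction with
  | zero => rw [epoch_zero, gapReversal_zero, Fin.rev_zero, epoch_last]
  | succ i ih =>
    rw [epoch_succ, ih, gapReversal_succ, Fin.rev_castSucc, epoch_succ, Fin.rev_succ]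
    ring

lemma gapReversal_mem_gapSimplex_iff {n : ℕ} (t : ℝ) (x : Fin (n + 1) → ℝ) :
    gapReversal n t x ∈ gapSimplex (n + 1) t ↔ x ∈ gapSimplex (n + 1) t := by
  simp only [gapSimplex, Set.mem_ofPred_eq, sum_gapReversal, Fin.forall_fin_succ, gapReversal_zero,
    gapReversal_succ]
  have : (∀ i : Fin n, 0 ≤ x i.rev.succ) ↔ ∀ i : Fin n, 0 ≤ x i.succ :=
    Fin.revPerm.forall_congr_right (q := fun i : Fin n => 0 ≤ x i.succ)
  rw [this]
  constructor
  · rintro ⟨⟨h1, h2⟩, h3⟩; exact ⟨⟨by linarith, h2⟩, by linarith⟩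
  · rintro ⟨⟨h1, h2⟩, h3⟩; exact ⟨⟨by linarith, h2⟩, by linarith⟩

lemma measurePreserving_gapReversal (n : ℕ) (t : ℝ) :
    MeasurePreserving (gapReversal n t) volume volume := by
  have hdet := abs_det_gapReversalLinear n
  have h1 : MeasurePreserving (gapReversalLinear n) volume volume := by
    refine ⟨(LinearMap.continuous_of_finiteDimensional _).measurable, ?_⟩
    rw [Measure.map_linearMap_addHaar_eq_smul_addHaar _ (by intro h; simp [h] at hdet), abs_inv,
      hdet]
    simp
  exact (measurePreserving_add_left volume _).comp h1

lemma expMeasure_Ioi {r : ℝ} (hr : 0 < r) {s : ℝ} (hs : 0 ≤ s) :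
    expMeasure r (Set.Ioi s) = ENNReal.ofReal (Real.exp (-(r * s))) := by
  have := isProbabilityMeasure_expMeasure hr
  have h := cdf_expMeasure_eq hr s
  rw [cdf_eq_real, if_pos hs] at h
  rw [← Set.compl_Iic, ← ofReal_measureReal, measureReal_compl measurableSet_Iic, h]
  simp

/-- Given the number of points of a Poisson process in `[0, t]`, the configuration of points is
invariant under time reversal. -/
lemma lintegral_gapSimplex_reverse {r : ℝ} (hr : 0 < r) (t : ℝ) (n : ℕ)
    {g : (Fin n → ℝ) → ℝ≥0∞} (hg : Measurable g) (hsymm : ∀ s, g (fun i => s i.rev) = g s) :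
    ∫⁻ x in gapSimplex n t, g (fun i => t - epoch x i) * expMeasure r (Set.Ioi (t - ∑ i, x i))
        ∂(Measure.pi fun _ => expMeasure r)
      = ∫⁻ x in gapSimplex n t, g (fun i => epoch x i) * expMeasure r (Set.Ioi (t - ∑ i, x i))
        ∂(Measure.pi fun _ => expMeasure r) := by
  have := isProbabilityMeasure_expMeasure hr
  have hexp : expMeasure r = volume.withDensity (exponentialPDF r) := rfl
  have hpdf : Measurable (exponentialPDF r) := (measurable_exponentialPDFReal r).ennreal_ofReal
  have htail : Measurable fun x : Fin n → ℝ => expMeasure r (Set.Ioi (t - ∑ i, x i)) := by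
    have : Antitone fun s : ℝ => expMeasure r (Set.Ioi s) :=
      fun a b h => measure_mono (Set.Ioi_subset_Ioi h)
    exact this.measurable.comp (by fun_prop)
  have hmeas := measurableSet_gapSimplex n t
  -- On the simplex, the product of the densities `r * exp (-r * x i)` and the probability of no
  -- further point before `t` is the constant `r ^ n * exp (-r * t)`. The weighted measure is thus a
  -- multiple of Lebesgue measure, which the reversal preserves.
  have key : ∀ h : (Fin n → ℝ) → ℝ≥0∞, Measurable h →
      ∫⁻ x in gapSimplex n t, h x * expMeasure r (Set.Ioi (t - ∑ i, x i))
        ∂(Measure.pi fun _ => expMeasure r)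
      = ∫⁻ x in gapSimplex n t, ENNReal.ofReal (r ^ n * Real.exp (-(r * t))) * h x := by
    intro h hh
    have : SigmaFinite (volume.withDensity (exponentialPDF r)) := by rw [← hexp]; infer_instance
    rw [← lintegral_indicator hmeas]
    refine (lintegral_pi_withDensity hpdf n ((hh.mul htail).indicator hmeas)).trans ?_
    rw [← lintegral_indicator hmeas]
    refine lintegral_congr fun x => ?_
    by_cases hx : x ∈ gapSimplex n t
    · rw [Set.indicator_of_mem hx, Set.indicator_of_mem hx,
        Pi.mul_apply, expMeasure_Ioi hr (sub_nonneg.2 hx.2), mul_comm (h x), ← mul_assoc]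
      congr 1
      rw [Finset.prod_congr rfl fun i _ => exponentialPDF_of_nonneg (hx.1 i),
        ← ENNReal.ofReal_prod_of_nonneg (fun i _ => by positivity),
        ← ENNReal.ofReal_mul (Finset.prod_nonneg fun i _ => by positivity),
        Finset.prod_mul_distrib, ← Real.exp_sum, mul_assoc, ← Real.exp_add]
      simp only [Finset.prod_const, Finset.card_univ, Fintype.card_fin, Finset.sum_neg_distrib,
        ← Finset.mul_sum]
      congr 3
      ring
    · simp [Set.indicator_of_notMem hx]
  have hm1 : Measurable fun x : Fin n → ℝ => g fun i => t - epoch x i :=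
    hg.comp (measurable_pi_lambda _ fun i => measurable_const.sub (measurable_epoch i))
  have hm2 : Measurable fun x : Fin n → ℝ => g fun i => epoch x i :=
    hg.comp (measurable_pi_lambda _ fun i => measurable_epoch i)
  rw [key _ hm1, key _ hm2]
  cases n with
  | zero => congr! 4 with x
  | succ n =>
    rw [← lintegral_indicator hmeas, ← lintegral_indicator hmeas,
      ← (measurePreserving_gapReversal n t).lintegral_comp ((hm1.const_mul _).indicator hmeas)]
    refine lintegral_congr fun x => ?_
    by_cases hx : x ∈ gapSimplex (n + 1) t
    · rw [Set.indicator_of_mem hx,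
        Set.indicator_of_mem ((gapReversal_mem_gapSimplex_iff t x).2 hx)]
      simp only [epoch_gapReversal, sub_sub_cancel]
      -- Reflection leaves the points in reverse order; the symmetry of `g` absorbs this.
      rw [hsymm fun i => epoch x i]
    · rw [Set.indicator_of_notMem hx,
        Set.indicator_of_notMem (mt (gapReversal_mem_gapSimplex_iff t x).1 hx)]

end GapReversal

/-! ### Freezing an independent variable -/

section Fubini

variable {Ω E : Type*} [mΩ : MeasurableSpace Ω] [MeasurableSpace E]

lemma measure_prodMk_of_indepFun {Ω' : Type*} [MeasurableSpace Ω'] {P : Measure Ω}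
    [IsProbabilityMeasure P] {G : Ω → E} {W : Ω → Ω'} (hG : Measurable G) (hW : Measurable W)
    (h : IndepFun G W P) {A : Set (E × Ω')} (hA : MeasurableSet A) :
    Measurable (fun x => P {ω | (x, W ω) ∈ A}) ∧
      P {ω | (G ω, W ω) ∈ A} = ∫⁻ x, P {ω | (x, W ω) ∈ A} ∂(P.map G) := by
  have h1 : ∀ x, P {ω | (x, W ω) ∈ A} = P.map W (Prod.mk x ⁻¹' A) := fun x => by
    rw [Measure.map_apply hW (measurable_prodMk_left hA)]; rfl
  have : IsProbabilityMeasure (P.map W) := Measure.isProbabilityMeasure_map hW.aemeasurable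
  have : IsProbabilityMeasure (P.map G) := Measure.isProbabilityMeasure_map hG.aemeasurable
  refine ⟨?_, ?_⟩
  · simp_rw [h1]
    exact measurable_measure_prodMk_left hA
  · simp_rw [h1]
    rw [← Measure.prod_apply hA, ← (indepFun_iff_map_prod_eq_prod_map_map hG.aemeasurable
      hW.aemeasurable).1 h, Measure.map_apply (hG.prodMk hW) hA]
    rfl

/-- If `G` is independent of the σ-algebra `m`, then an event that depends on `G` and `m` may be
evaluated by freezing `G`. -/
lemma measure_prodMk_of_indep {P : Measure Ω} [IsProbabilityMeasure P] {G : Ω → E}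
    (hG : Measurable G) {μ : Measure E} (hμ : P.map G = μ) {m : MeasurableSpace Ω} (hm : m ≤ mΩ)
    (h : Indep (MeasurableSpace.comap G inferInstance) m P) {A : Set (E × Ω)}
    (hA : MeasurableSet[MeasurableSpace.prod inferInstance m] A) :
    Measurable (fun x => P {ω | (x, ω) ∈ A}) ∧
      P {ω | (G ω, ω) ∈ A} = ∫⁻ x, P {ω | (x, ω) ∈ A} ∂μ := by
  subst hμ
  -- The second variable is the identity from `Ω` to `Ω` equipped with the smaller σ-algebra `m`.
  refine @measure_prodMk_of_indepFun Ω E mΩ _ Ω m P _ G id hG (measurable_id'' hm) ?_ A hA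
  rw [IndepFun_iff_Indep, MeasurableSpace.comap_id]
  exact h

end Fubini

/-! ### Joint law and exchangeability of the batch data -/

section Sources

variable {Ω : Type*} {J : ℕ}

/-- The indicator vector of a position. -/
def positionVector (x : Option (Fin J)) (k : Fin J) : ℕ := if x = some k then 1 else 0

/-- The batch vector and the position indicators at age `s` of all potential members of batch
`i`, as one family of random vectors. -/
def batchData (B : ℕ → Ω → Fin J → ℕ) (X : ℕ → Fin J → ℕ → ℝ≥0 → Ω → Option (Fin J))
    (i : ℕ) (s : ℝ≥0) : Option (Fin J × ℕ) → Ω → Fin J → ℕ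
  | none => B i
  | some (j, ℓ) => fun ω => positionVector (X i j ℓ s ω)

/-- The sum of the position indicators over the actual members of a batch. -/
def batchTotal (z : Option (Fin J × ℕ) → Fin J → ℕ) (k : Fin J) : ℕ :=
  ∑ j, ∑ ℓ ∈ Finset.range (z none j), z (some (j, ℓ)) k

/-- The numbers of customers of batch `i` in the queues at age `s`. -/
def contribution (B : ℕ → Ω → Fin J → ℕ) (X : ℕ → Fin J → ℕ → ℝ≥0 → Ω → Option (Fin J))
    (i : ℕ) (s : ℝ≥0) (ω : Ω) : Fin J → ℕ :=
  batchTotal fun x => batchData B X i s x ω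

lemma measurable_batchTotal :
    Measurable (batchTotal : (Option (Fin J × ℕ) → Fin J → ℕ) → Fin J → ℕ) := by
  refine measurable_pi_lambda _ fun k => ?_
  unfold batchTotal
  refine Finset.measurable_sum _ fun j _ => ?_
  -- The number of summands is itself random; since it takes countably many values, it can be fixed
  -- first.
  have h : Measurable fun p : ℕ × (Option (Fin J × ℕ) → Fin J → ℕ) =>
      ∑ ℓ ∈ Finset.range p.1, p.2 (some (j, ℓ)) k :=
    measurable_from_prod_countable_right fun n =>
      Finset.measurable_sum (Finset.range n) fun ℓ _ => by fun_prop
  exact h.comp (f := fun z : Option (Fin J × ℕ) → Fin J → ℕ => (z none j, z)) (by fun_prop)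

/-- The source of randomness of each component of `batchData`. -/
def dataSource : ℕ × Option (Fin J × ℕ) → Source J
  | (i, none) => .batch i
  | (i, some (j, ℓ)) => .route i j ℓ

lemma dataSource_injective : Function.Injective (dataSource (J := J)) := by
  rintro ⟨i, _ | ⟨j, ℓ⟩⟩ ⟨i', _ | ⟨j', ℓ'⟩⟩ h <;> simp_all [dataSource]

/-- The σ-algebra of all batch vectors and all routes. -/
@[reducible]
def dataSigma (T : ℕ → Ω → ℝ) (B : ℕ → Ω → Fin J → ℕ)
    (X : ℕ → Fin J → ℕ → ℝ≥0 → Ω → Option (Fin J)) : MeasurableSpace Ω :=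
  ⨆ p ∈ Set.range (dataSource (J := J)), sourceSigma T B X p

lemma sourceSigma_le_dataSigma (T : ℕ → Ω → ℝ) (B : ℕ → Ω → Fin J → ℕ)
    (X : ℕ → Fin J → ℕ → ℝ≥0 → Ω → Option (Fin J)) (p : ℕ × Option (Fin J × ℕ)) :
    sourceSigma T B X (dataSource p) ≤ dataSigma T B X :=
  le_iSup₂_of_le (dataSource p) ⟨p, rfl⟩ le_rfl

lemma comap_batchData_le (T : ℕ → Ω → ℝ) (B : ℕ → Ω → Fin J → ℕ)
    (X : ℕ → Fin J → ℕ → ℝ≥0 → Ω → Option (Fin J)) (i : ℕ) (s : ℝ≥0)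
    (x : Option (Fin J × ℕ)) :
    MeasurableSpace.comap (batchData B X i s x) inferInstance
      ≤ sourceSigma T B X (dataSource (i, x)) := by
  match x with
  | none => exact le_rfl
  | some (j, ℓ) =>
    rintro _ ⟨U, -, rfl⟩
    exact le_iSup (fun s => MeasurableSpace.comap (X i j ℓ s) ⊤) s _
      ⟨positionVector ⁻¹' U, trivial, rfl⟩

variable [mΩ : MeasurableSpace Ω] {P : Measure Ω} {lam : ℝ} {ν : Measure (Fin J → ℕ)}
  {q : Fin J → Fin J → ℝ≥0 → ℝ} {T : ℕ → Ω → ℝ} {B : ℕ → Ω → Fin J → ℕ}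
  {X : ℕ → Fin J → ℕ → ℝ≥0 → Ω → Option (Fin J)}

namespace IsNetwork

lemma measurable_interarrival (hnet : IsNetwork P lam ν q T B X) (i : ℕ) :
    Measurable (interarrival T i) := by
  cases i with
  | zero => exact hnet.measurable_arrival 0
  | succ i => exact (hnet.measurable_arrival (i + 1)).sub (hnet.measurable_arrival i)

lemma sourceSigma_le (hnet : IsNetwork P lam ν q T B X) (p : Source J) :
    sourceSigma T B X p ≤ mΩ := by
  cases p with
  | gap i => exact (hnet.measurable_interarrival i).comap_le
  | batch i => exact (hnet.measurable_batch i).comap_le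
  | route i j ℓ => exact iSup_le fun s => (hnet.measurable_position i j ℓ s).comap_le

lemma dataSigma_le (hnet : IsNetwork P lam ν q T B X) : dataSigma T B X ≤ mΩ :=
  iSup₂_le fun p _ => hnet.sourceSigma_le p

lemma measurable_batchData (hnet : IsNetwork P lam ν q T B X) (i : ℕ) (s : ℝ≥0)
    (x : Option (Fin J × ℕ)) : Measurable (batchData B X i s x) :=
  measurable_iff_comap_le.2 ((comap_batchData_le T B X i s x).trans (hnet.sourceSigma_le _))

lemma measurable_batchData_prod (hnet : IsNetwork P lam ν q T B X) (i : ℕ)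
    (x : Option (Fin J × ℕ)) :
    Measurable[MeasurableSpace.prod inferInstance (dataSigma T B X)]
      (fun p : ℝ≥0 × Ω => batchData B X i p.1 x p.2) := by
  match x with
  | none =>
    have h : Measurable[dataSigma T B X] (B i) :=
      measurable_iff_comap_le.2 (sourceSigma_le_dataSigma T B X (i, none))
    exact h.comp (@measurable_snd _ _ _ (dataSigma T B X))
  | some (j, ℓ) =>
    intro U _
    have h := hnet.measurable_route i j ℓ (t := positionVector ⁻¹' U) trivial
    refine sup_le_sup le_rfl (MeasurableSpace.comap_mono ?_) _ h
    exact sourceSigma_le_dataSigma T B X (i, some (j, ℓ))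

/-- Joint measurability is needed relative to `dataSigma`, not just the ambient σ-algebra: the
former is independent of the gaps, so ages built from the gaps can be frozen. -/
lemma measurable_contribution_prod (hnet : IsNetwork P lam ν q T B X) (i : ℕ) :
    Measurable[MeasurableSpace.prod inferInstance (dataSigma T B X)]
      (fun p : ℝ≥0 × Ω => contribution B X i p.1 p.2) :=
  measurable_batchTotal.comp
    (@measurable_pi_lambda _ _ _ (MeasurableSpace.prod inferInstance (dataSigma T B X)) _ _
      fun x => hnet.measurable_batchData_prod i x)

/-- The network prescribes only the masses of the states `some k`; total mass one then determines
that of `none`, hence the whole law. -/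
lemma measure_position_preimage_eq [IsProbabilityMeasure P] (hnet : IsNetwork P lam ν q T B X)
    (i i' : ℕ) (j : Fin J) (ℓ ℓ' : ℕ) (s : ℝ≥0) (S : Set (Option (Fin J))) :
    P (X i j ℓ s ⁻¹' S) = P (X i' j ℓ' s ⁻¹' S) := by
  let _ : MeasurableSpace (Option (Fin J)) := ⊤
  have : MeasurableSingletonClass (Option (Fin J)) := ⟨fun _ => trivial⟩
  have hX := fun i ℓ => hnet.measurable_position i j ℓ s
  have := fun i ℓ => Measure.isProbabilityMeasure_map (μ := P) (hX i ℓ).aemeasurable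
  have hsome : ∀ k, P.map (X i j ℓ s) {some k} = P.map (X i' j ℓ' s) {some k} := fun k => by
    rw [Measure.map_apply (hX i ℓ) trivial, Measure.map_apply (hX i' ℓ') trivial,
      ← ofReal_measureReal, ← ofReal_measureReal]
    congr 1
    exact (hnet.law_position i j ℓ s k).trans (hnet.law_position i' j ℓ' s k).symm
  have hsum : ∀ i ℓ, P.map (X i j ℓ s) {none} + ∑ k, P.map (X i j ℓ s) {some k} = 1 :=
    fun i ℓ => by
      rw [← Fintype.sum_option fun x => P.map (X i j ℓ s) {x}, sum_measure_singleton]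
      simp
  have hnone : P.map (X i j ℓ s) {none} = P.map (X i' j ℓ' s) {none} := by
    have h := (hsum i ℓ).trans (hsum i' ℓ').symm
    simp_rw [hsome] at h
    refine (ENNReal.add_left_inj ?_).1 h
    exact (ENNReal.sum_lt_top.2 fun k _ => measure_lt_top _ _).ne
  have h : P.map (X i j ℓ s) = P.map (X i' j ℓ' s) :=
    Measure.ext_of_singleton fun x => by cases x with
      | none => exact hnone
      | some k => exact hsome k
  rw [← Measure.map_apply (hX i ℓ) trivial, h, Measure.map_apply (hX i' ℓ') trivial]

lemma map_batchData_eq [IsProbabilityMeasure P] (hnet : IsNetwork P lam ν q T B X)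
    (i : ℕ) (s : ℝ≥0) (x : Option (Fin J × ℕ)) :
    P.map (batchData B X i s x) = P.map (batchData B X 0 s x) := by
  match x with
  | none => exact (hnet.law_batch i).trans (hnet.law_batch 0).symm
  | some (j, ℓ) =>
    ext U hU
    rw [Measure.map_apply (hnet.measurable_batchData i s _) hU,
      Measure.map_apply (hnet.measurable_batchData 0 s _) hU]
    exact hnet.measure_position_preimage_eq i 0 j ℓ ℓ s (positionVector ⁻¹' U)

lemma iIndepFun_batchData (hnet : IsNetwork P lam ν q T B X) {ι : Type*} {f : ι → ℕ}
    (hf : Function.Injective f) (s : ι → ℝ≥0) :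
    iIndepFun (fun (p : ι × Option (Fin J × ℕ)) ω => batchData B X (f p.1) (s p.1) p.2 ω) P := by
  have hinj : Function.Injective fun p : ι × Option (Fin J × ℕ) => dataSource (f p.1, p.2) :=
    dataSource_injective.comp (hf.prodMap Function.injective_id)
  exact iIndep_of_iIndep_of_le (hnet.independent.precomp hinj)
    fun p => comap_batchData_le T B X (f p.1) (s p.1) p.2

/-- In the product law, batch `i` enters only through its age. Permuting the ages therefore amounts
to relabelling the factors. -/
lemma map_batchData_prod [IsProbabilityMeasure P] (hnet : IsNetwork P lam ν q T B X)
    {n : ℕ} (s : Fin n → ℝ≥0) :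
    P.map (fun ω (p : Fin n × Option (Fin J × ℕ)) => batchData B X p.1 (s p.1) p.2 ω)
      = Measure.infinitePi fun p : Fin n × Option (Fin J × ℕ) =>
        P.map (batchData B X 0 (s p.1) p.2) := by
  rw [(hnet.iIndepFun_batchData Fin.val_injective s).map_fun_eq_infinitePi_map
    fun p => hnet.measurable_batchData _ _ _]
  simp_rw [hnet.map_batchData_eq]

/-- The joint law of the contributions of the first `n` batches does not depend on the order of
their ages. -/
lemma measure_sum_contribution_rev [IsProbabilityMeasure P] (hnet : IsNetwork P lam ν q T B X)
    {n : ℕ} (s : Fin n → ℝ≥0) (a : Fin J → ℕ) :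
    P {ω | ∑ i : Fin n, contribution B X i (s i.rev) ω = a}
      = P {ω | ∑ i : Fin n, contribution B X i (s i) ω = a} := by
  let D : Set (Fin n × Option (Fin J × ℕ) → Fin J → ℕ) :=
    {z | ∑ i, batchTotal (fun x => z (i, x)) = a}
  have hD : MeasurableSet D := by
    refine measurableSet_eq_fun (Finset.measurable_sum _ fun i _ => ?_) measurable_const
    exact measurable_batchTotal.comp (by fun_prop)
  have := fun (s : ℝ≥0) (x : Option (Fin J × ℕ)) =>
    Measure.isProbabilityMeasure_map (μ := P) (hnet.measurable_batchData 0 s x).aemeasurable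
  have hP : ∀ s : Fin n → ℝ≥0, P {ω | ∑ i : Fin n, contribution B X i (s i) ω = a}
      = Measure.infinitePi (fun p : Fin n × Option (Fin J × ℕ) =>
        P.map (batchData B X 0 (s p.1) p.2)) D := fun s => by
    rw [← hnet.map_batchData_prod s, Measure.map_apply
      (measurable_pi_lambda _ fun p => hnet.measurable_batchData _ _ _) hD]
    rfl
  rw [hP, hP]
  have hinj : Function.Injective
      fun p : Fin n × Option (Fin J × ℕ) => (p.1.rev, p.2) :=
    Fin.rev_injective.prodMap Function.injective_id
  rw [← Measure.map_infinitePi_infinitePi_of_inj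
    (P := fun p : Fin n × Option (Fin J × ℕ) => P.map (batchData B X 0 (s p.1) p.2)) hinj,
    Measure.map_apply (by fun_prop) hD]
  congr 1
  ext z
  simp only [D, Set.mem_preimage, Set.mem_ofPred_eq]
  rw [← Equiv.sum_comp Fin.revPerm fun i => batchTotal fun x => z (i, x)]
  rfl

end IsNetwork

end Sources

/-! ### Arrival times and the number of arrivals -/

section Arrivals

variable {Ω : Type*}

lemma sum_interarrival (T : ℕ → Ω → ℝ) (i : ℕ) (ω : Ω) :
    ∑ j ∈ Finset.range (i + 1), interarrival T j ω = T i ω := by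
  induction i with
  | zero => simp [interarrival]
  | succ i ih => rw [Finset.sum_range_succ, ih]; simp [interarrival]

/-- The first `n` gaps between arrivals. -/
def gapVector (T : ℕ → Ω → ℝ) (n : ℕ) (ω : Ω) (i : Fin n) : ℝ := interarrival T i ω

lemma epoch_gapVector (T : ℕ → Ω → ℝ) {n : ℕ} (ω : Ω) (i : Fin n) :
    epoch (gapVector T n ω) i = T i ω := by
  cases n with
  | zero => exact i.elim0
  | succ n =>
    induction i using Fin.induction with
    | zero => rw [epoch_zero]; rfl
    | succ i ih => rw [epoch_succ, ih]; simp [gapVector, interarrival]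

/-- The event that exactly the first `n` arrivals take place in `[0, t]`. -/
def countEvent (T : ℕ → Ω → ℝ) (t : ℝ) (n : ℕ) : Set Ω :=
  {ω | gapVector T n ω ∈ gapSimplex n t ∧ t - ∑ i, gapVector T n ω i < interarrival T n ω}

lemma sum_gapVector (T : ℕ → Ω → ℝ) (n : ℕ) (ω : Ω) :
    ∑ i, gapVector T n ω i = ∑ j ∈ Finset.range n, interarrival T j ω :=
  Fin.sum_univ_eq_sum_range (fun j => interarrival T j ω) n

lemma mem_countEvent_iff {T : ℕ → Ω → ℝ} {t : ℝ} {n : ℕ} {ω : Ω} :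
    ω ∈ countEvent T t n ↔ (∀ i < n, 0 ≤ interarrival T i ω) ∧
      ∑ j ∈ Finset.range n, interarrival T j ω ≤ t ∧ t < T n ω := by
  rw [← sum_interarrival T n ω, Finset.sum_range_succ, ← sub_lt_iff_lt_add']
  simp only [countEvent, gapSimplex, Set.mem_ofPred_eq, sum_gapVector, and_assoc]
  simp [gapVector, Fin.forall_iff]

lemma disjoint_countEvent (T : ℕ → Ω → ℝ) (t : ℝ) :
    Pairwise (Function.onFun Disjoint (countEvent T t)) := by
  refine (pairwise_disjoint_on _).2 fun m n hmn => Set.disjoint_left.2 fun ω hm hn => ?_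
  rw [mem_countEvent_iff] at hm hn
  have : T m ω ≤ ∑ j ∈ Finset.range n, interarrival T j ω := by
    rw [← sum_interarrival T m]
    exact Finset.sum_le_sum_of_subset_of_nonneg (Finset.range_mono (by omega))
      fun j hj _ => hn.1 j (Finset.mem_range.1 hj)
  linarith [hm.2.2, hn.2.1]

lemma arrival_le_iff_of_mem_countEvent {T : ℕ → Ω → ℝ} {t : ℝ} {n : ℕ} {ω : Ω}
    (hω : ∀ i, 0 ≤ interarrival T i ω) (h : ω ∈ countEvent T t n) (i : ℕ) :
    T i ω ≤ t ↔ i < n := by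
  rw [mem_countEvent_iff] at h
  constructor
  · intro hi
    by_contra hn
    have : T n ω ≤ T i ω := by
      rw [← sum_interarrival T, ← sum_interarrival T]
      exact Finset.sum_le_sum_of_subset_of_nonneg (Finset.range_mono (by omega))
        fun j _ _ => hω j
    linarith
  · intro hi
    rw [← sum_interarrival T]
    exact (Finset.sum_le_sum_of_subset_of_nonneg (Finset.range_mono (by omega))
      fun j _ _ => hω j).trans h.2.1

lemma exists_mem_countEvent {T : ℕ → Ω → ℝ} {t : ℝ} (ht : 0 ≤ t) {ω : Ω}
    (hω : ∀ i, 0 ≤ interarrival T i ω) (h : ∃ i, t < T i ω) : ∃ n, ω ∈ countEvent T t n := by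
  classical
  refine ⟨Nat.find h, mem_countEvent_iff.2 ⟨fun i _ => hω i, ?_, Nat.find_spec h⟩⟩
  rcases hn : Nat.find h with _ | n
  · simpa using ht
  · rw [sum_interarrival]
    exact not_lt.1 (Nat.find_min h (by omega))

lemma measurable_interarrival_iSup (T : ℕ → Ω → ℝ) (i : ℕ) :
    Measurable[⨆ i, MeasurableSpace.comap (interarrival T i) inferInstance] (interarrival T i) :=
  measurable_iff_comap_le.2
    (le_iSup (fun i => MeasurableSpace.comap (interarrival T i) inferInstance) i)

lemma measurable_arrival_iSup (T : ℕ → Ω → ℝ) (i : ℕ) :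
    Measurable[⨆ i, MeasurableSpace.comap (interarrival T i) inferInstance] (T i) := by
  have h : T i = fun ω => ∑ j ∈ Finset.range (i + 1), interarrival T j ω :=
    funext fun ω => (sum_interarrival T i ω).symm
  rw [h]
  exact @Finset.measurable_sum _ _ _ _ _ _
    (⨆ i, MeasurableSpace.comap (interarrival T i) inferInstance) _ _
    fun j _ => measurable_interarrival_iSup T j

lemma measurable_gapVector_iSup (T : ℕ → Ω → ℝ) (n : ℕ) :
    Measurable[⨆ i, MeasurableSpace.comap (interarrival T i) inferInstance] (gapVector T n) :=
  @measurable_pi_lambda _ _ _ (⨆ i, MeasurableSpace.comap (interarrival T i) inferInstance) _ _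
    fun i => measurable_interarrival_iSup T i

end Arrivals

/-! ### Conditioning on the number of arrivals -/

section Measure

variable {Ω : Type*} [MeasurableSpace Ω]

/-- Only the partition has to be measurable, so the lemma applies to occupancy events whose
measurability has not been established. -/
lemma measure_eq_of_forall_inter_eq {P : Measure Ω} {E : ℕ → Set Ω}
    (hE : ∀ n, MeasurableSet (E n)) (hdisj : Pairwise (Function.onFun Disjoint E))
    (hcover : ∀ᵐ ω ∂P, ∃ n, ω ∈ E n) {U V : Set Ω} (h : ∀ n, P (U ∩ E n) = P (V ∩ E n)) :
    P U = P V := by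
  have key : ∀ U, P U = ∑' n, P (U ∩ E n) := fun U => by
    have h1 : P U = P.restrict (⋃ n, E n) U := by
      rw [Measure.restrict_eq_self_of_ae_mem (by simpa using hcover)]
    rw [h1, Measure.restrict_iUnion hdisj hE, Measure.sum_apply_of_countable]
    simp_rw [Measure.restrict_apply' (hE _)]
  rw [key U, key V]
  simp_rw [h]

lemma measurableSet_sum_comp_eq {E ι κ : Type*} [MeasurableSpace E] [Fintype ι] [Countable κ]
    {C : ι → ℝ≥0 → Ω → κ → ℕ} (hC : ∀ i, Measurable fun p : ℝ≥0 × Ω => C i p.1 p.2)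
    {φ : ι → E → ℝ≥0} (hφ : ∀ i, Measurable (φ i)) (a : κ → ℕ) :
    MeasurableSet {p : E × Ω | ∑ i, C i (φ i p.1) p.2 = a} := by
  refine measurableSet_eq_fun (Finset.measurable_sum _ fun i _ => ?_) measurable_const
  exact (hC i).comp (f := fun p : E × Ω => (φ i p.1, p.2)) (by fun_prop)

/-- The probability that the first `n` batches, at ages `s`, contribute the vector `a`. -/
noncomputable def batchProb {J : ℕ} (P : Measure Ω) (B : ℕ → Ω → Fin J → ℕ)
    (X : ℕ → Fin J → ℕ → ℝ≥0 → Ω → Option (Fin J)) (n : ℕ) (a : Fin J → ℕ) (s : Fin n → ℝ) :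
    ℝ≥0∞ :=
  P {ω | ∑ i : Fin n, contribution B X i (s i).toNNReal ω = a}

end Measure

namespace IsNetwork

variable {Ω : Type*} {J : ℕ} [mΩ : MeasurableSpace Ω] {P : Measure Ω} {lam : ℝ}
  {ν : Measure (Fin J → ℕ)}
  {q : Fin J → Fin J → ℝ≥0 → ℝ} {T : ℕ → Ω → ℝ} {B : ℕ → Ω → Fin J → ℕ}
  {X : ℕ → Fin J → ℕ → ℝ≥0 → Ω → Option (Fin J)}

/-- Any random variable determined by the gaps is independent of the batch vectors and routes. -/
lemma indep_dataSigma (hnet : IsNetwork P lam ν q T B X) {E : Type*} [MeasurableSpace E]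
    {G : Ω → E} (hG : Measurable[⨆ i, MeasurableSpace.comap (interarrival T i) inferInstance] G) :
    Indep (MeasurableSpace.comap G inferInstance) (dataSigma T B X) P := by
  have hdisj : Disjoint (Set.range (Source.gap (J := J))) (Set.range (dataSource (J := J))) := by
    rw [Set.disjoint_left]
    rintro _ ⟨i, rfl⟩ ⟨⟨i', _ | ⟨j, ℓ⟩⟩, h⟩ <;> simp [dataSource] at h
  refine indep_of_indep_of_le_left
    (indep_iSup_of_disjoint hnet.sourceSigma_le hnet.independent hdisj) ?_
  refine hG.comap_le.trans (iSup_le fun i => ?_)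
  exact le_iSup₂_of_le (f := fun p (_ : p ∈ Set.range (Source.gap (J := J))) =>
    sourceSigma T B X p) (Source.gap i) ⟨i, rfl⟩ le_rfl

lemma measurable_gapVector (hnet : IsNetwork P lam ν q T B X) (n : ℕ) :
    Measurable (gapVector T n) :=
  measurable_pi_lambda _ fun i => hnet.measurable_interarrival i

lemma measurableSet_countEvent (hnet : IsNetwork P lam ν q T B X) (t : ℝ) (n : ℕ) :
    MeasurableSet (countEvent T t n) := by
  have h := hnet.measurable_gapVector n
  refine (h (measurableSet_gapSimplex n t)).inter
    (measurableSet_lt ?_ (hnet.measurable_interarrival n))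
  exact measurable_const.sub (Finset.measurable_sum _ fun i _ => (measurable_pi_apply i).comp h)

lemma iIndepFun_interarrival (hnet : IsNetwork P lam ν q T B X) :
    iIndepFun (interarrival T) P :=
  hnet.independent.precomp (g := Source.gap) fun _ _ h => Source.gap.inj h

/-- The joint law of the `n`-th gap and the gaps before it. -/
lemma map_interarrival_gapVector [IsProbabilityMeasure P] (hnet : IsNetwork P lam ν q T B X)
    (n : ℕ) :
    P.map (fun ω => (interarrival T n ω, gapVector T n ω))
      = (expMeasure lam).prod (Measure.pi fun _ : Fin n => expMeasure lam) := by
  have := isProbabilityMeasure_expMeasure hnet.rate_pos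
  have h : P.map (gapVector T (n + 1)) = Measure.pi fun _ : Fin (n + 1) => expMeasure lam := by
    have hind : iIndepFun (fun i : Fin (n + 1) => interarrival T i) P :=
      hnet.iIndepFun_interarrival.precomp Fin.val_injective
    have hm : ∀ i : Fin (n + 1), AEMeasurable (fun ω => interarrival T i ω) P :=
      fun i => (hnet.measurable_interarrival i).aemeasurable
    have h := iIndepFun.map_fun_eq_pi_map hm hind
    simp_rw [hnet.law_interarrival] at h
    exact h
  rw [← (measurePreserving_piFinSuccAbove (fun _ : Fin (n + 1) => expMeasure lam)
    (Fin.last n)).map_eq, ← h, Measure.map_map (MeasurableEquiv.measurable _)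
      (hnet.measurable_gapVector _)]
  congr 1
  ext ω
  · rfl
  · simp [gapVector, MeasurableEquiv.piFinSuccAbove, Fin.init]

lemma measurableSet_sum_contribution (hnet : IsNetwork P lam ν q T B X) {E : Type*}
    [MeasurableSpace E] {n : ℕ} {φ : Fin n → E → ℝ≥0} (hφ : ∀ i, Measurable (φ i))
    (a : Fin J → ℕ) :
    MeasurableSet[MeasurableSpace.prod inferInstance (dataSigma T B X)]
      {p : E × Ω | ∑ i : Fin n, contribution B X i (φ i p.1) p.2 = a} := by
  exact @measurableSet_sum_comp_eq Ω (dataSigma T B X) E (Fin n) (Fin J) _ _ _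
    (fun i => contribution B X i) (fun i => hnet.measurable_contribution_prod i) φ hφ a

lemma measurable_batchProb [IsProbabilityMeasure P] (hnet : IsNetwork P lam ν q T B X) (n : ℕ)
    (a : Fin J → ℕ) : Measurable (batchProb P B X n a) :=
  (measure_prodMk_of_indep (hnet.measurable_gapVector n) rfl hnet.dataSigma_le
    (hnet.indep_dataSigma (measurable_gapVector_iSup T n))
    (hnet.measurableSet_sum_contribution (E := Fin n → ℝ) (φ := fun i s => (s i).toNNReal)
      (fun i => by fun_prop) a)).1

/-- The probability that there are `n` arrivals in `[0, t]` and that their batches, at ages that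
depend on the gaps, contribute the vector `a`. -/
lemma measure_sum_contribution_inter_countEvent [IsProbabilityMeasure P]
    (hnet : IsNetwork P lam ν q T B X) (t : ℝ) (n : ℕ) {φ : (Fin n → ℝ) → Fin n → ℝ}
    (hφ : Measurable φ) (a : Fin J → ℕ) :
    P ({ω | ∑ i : Fin n, contribution B X i (φ (gapVector T n ω) i).toNNReal ω = a}
        ∩ countEvent T t n)
      = ∫⁻ x in gapSimplex n t, batchProb P B X n a (φ x)
          * expMeasure lam (Set.Ioi (t - ∑ i, x i)) ∂(Measure.pi fun _ => expMeasure lam) := by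
  have := isProbabilityMeasure_expMeasure hnet.rate_pos
  -- The gaps before index `n` fix the arrivals, while gap `n` serves only to exclude a further
  -- arrival; integrating it out yields the exponential tail factor.
  let D : Set (ℝ × (Fin n → ℝ)) := {p | p.2 ∈ gapSimplex n t ∧ t - ∑ i, p.2 i < p.1}
  have hD : MeasurableSet D :=
    (measurable_snd (measurableSet_gapSimplex n t)).inter
      (measurableSet_lt (by fun_prop) measurable_fst)
  have hA1 := hnet.measurableSet_sum_contribution (E := ℝ × (Fin n → ℝ))
    (φ := fun i p => (φ p.2 i).toNNReal) (fun i => by fun_prop) a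
  have hA2 : MeasurableSet[MeasurableSpace.prod inferInstance (dataSigma T B X)]
      {p : (ℝ × (Fin n → ℝ)) × Ω | p.1 ∈ D} :=
    @measurable_fst _ _ _ (dataSigma T B X) _ hD
  have h := (measure_prodMk_of_indep
    ((hnet.measurable_interarrival n).prodMk (hnet.measurable_gapVector n))
    (hnet.map_interarrival_gapVector n) hnet.dataSigma_le
    (hnet.indep_dataSigma (@Measurable.prodMk _ _ _ _ _ (_) _ _ (measurable_interarrival_iSup T n)
      (measurable_gapVector_iSup T n)))
    (@MeasurableSet.inter _ (_) _ _ hA1 hA2)).2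
  refine Eq.trans ?_ (h.trans ?_)
  · rfl
  have hind : ∀ p : ℝ × (Fin n → ℝ),
      P {ω | (p, ω) ∈ {p : (ℝ × (Fin n → ℝ)) × Ω |
          ∑ i : Fin n, contribution B X i (φ p.1.2 i).toNNReal p.2 = a} ∩ {p | p.1 ∈ D}}
        = D.indicator (fun p => batchProb P B X n a (φ p.2)) p := fun p => by
    by_cases hp : p ∈ D
    · rw [Set.indicator_of_mem hp]
      simp [hp, batchProb]
    · rw [Set.indicator_of_notMem hp]
      simp [hp]
  have hm : Measurable (D.indicator fun p => batchProb P B X n a (φ p.2)) :=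
    ((hnet.measurable_batchProb n a).comp (hφ.comp measurable_snd)).indicator hD
  simp_rw [hind]
  rw [lintegral_prod_symm _ hm.aemeasurable, ← lintegral_indicator (measurableSet_gapSimplex n t)]
  refine lintegral_congr fun x => ?_
  by_cases hx : x ∈ gapSimplex n t
  · rw [Set.indicator_of_mem hx, ← setLIntegral_const, ← lintegral_indicator measurableSet_Ioi]
    refine lintegral_congr fun y => ?_
    by_cases hy : t - ∑ i, x i < y
    · rw [Set.indicator_of_mem (show (y, x) ∈ D from ⟨hx, hy⟩),
        Set.indicator_of_mem (Set.mem_Ioi.2 hy)]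
    · rw [Set.indicator_of_notMem (fun h : (y, x) ∈ D => hy h.2),
        Set.indicator_of_notMem (fun h => hy (Set.mem_Ioi.1 h))]
  · rw [Set.indicator_of_notMem hx]
    simp [D, hx, Set.indicator]

/-- Time reversal: on the event of `n` arrivals in `[0, t]`, the batches may be observed at the
ages `T i` instead of `t - T i`. -/
lemma measure_sum_contribution_reverse [IsProbabilityMeasure P]
    (hnet : IsNetwork P lam ν q T B X) (t : ℝ) (n : ℕ) (a : Fin J → ℕ) :
    P ({ω | ∑ i : Fin n, contribution B X i (t - T i ω).toNNReal ω = a} ∩ countEvent T t n)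
      = P ({ω | ∑ i : Fin n, contribution B X i (T i ω).toNNReal ω = a} ∩ countEvent T t n) := by
  have hepoch : Measurable fun (x : Fin n → ℝ) i => epoch x i :=
    measurable_pi_lambda _ fun i => measurable_epoch i
  have h1 := hnet.measure_sum_contribution_inter_countEvent t n
    (φ := fun x i => t - epoch x i)
    (measurable_pi_lambda _ fun i => measurable_const.sub (measurable_epoch i)) a
  have h2 := hnet.measure_sum_contribution_inter_countEvent t n
    (φ := fun x i => epoch x i) hepoch a
  simp only [epoch_gapVector] at h1 h2
  rw [h1, h2]
  exact lintegral_gapSimplex_reverse hnet.rate_pos t n (hnet.measurable_batchProb n a)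
    fun s => hnet.measure_sum_contribution_rev (fun i => (s i).toNNReal) a

end IsNetwork
-- Summing truncated power tails
section Series

lemma tsum_div_eq {M : ℕ} [NeZero M] (f : ℕ → ℝ≥0∞) : ∑' i, f (i / M) = M * ∑' k, f k := by
  have h := (Nat.divModEquiv M).tsum_eq (fun p : ℕ × Fin M => f p.1)
  simp only [Nat.divModEquiv_apply] at h
  rw [h, ENNReal.tsum_prod (f := fun k (_ : Fin M) => f k), ← ENNReal.tsum_mul_left]
  simp

/-- A function that dominates `min 1 (k ^ (-α))`, including at `k = 0`. -/
noncomputable def powerTail (α : ℝ) (k : ℕ) : ℝ≥0∞ :=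
  (if k = 0 then 1 else 0) + ENNReal.ofReal ((k : ℝ) ^ (-α))

lemma tsum_powerTail_ne_top {α : ℝ} (hα : 1 < α) : ∑' k, powerTail α k ≠ ⊤ := by
  unfold powerTail
  rw [ENNReal.tsum_add, tsum_ite_eq]
  refine ENNReal.add_ne_top.2 ⟨ENNReal.one_ne_top, ?_⟩
  exact (Real.summable_nat_rpow.2 (by linarith)).tsum_ofReal_ne_top

lemma tsum_min_one_rpow_le {α c y : ℝ} (hα : 1 < α) (hc : 0 < c) (hy : 0 ≤ y) :
    ∑' i : ℕ, min 1 (ENNReal.ofReal (y * (c * i) ^ (-α)))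
      ≤ (ENNReal.ofReal (c⁻¹ * y ^ (1 / α)) + 2) * ∑' k, powerTail α k := by
  -- Blocks of length `M` make `c * i ≥ k * y ^ (1 / α)` for `i` in block `k`, so there `y * (c * i)
  -- ^ (-α) ≤ k ^ (-α)` when `k > 0`. Block `0` is bounded by `1` termwise. The `+ 1` keeps `M`
  -- nonzero, and `M` still exceeds `c⁻¹ * y ^ (1 / α)` by at most `2`.
  set M : ℕ := ⌈c⁻¹ * y ^ (1 / α)⌉₊ + 1 with hM
  have : NeZero M := ⟨by omega⟩
  have hyM : y ^ (1 / α) ≤ c * M := by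
    have : c⁻¹ * y ^ (1 / α) ≤ M := by
      rw [hM]; push_cast
      linarith [Nat.le_ceil (c⁻¹ * y ^ (1 / α))]
    rwa [inv_mul_le_iff₀ hc] at this
  calc ∑' i : ℕ, min 1 (ENNReal.ofReal (y * (c * i) ^ (-α)))
      ≤ ∑' i : ℕ, powerTail α (i / M) := by
        refine ENNReal.tsum_le_tsum fun i => ?_
        rcases Nat.eq_zero_or_pos (i / M) with h | h
        · rw [h, powerTail, if_pos rfl]
          exact (min_le_left _ _).trans le_self_add
        · rw [powerTail, if_neg h.ne', zero_add]
          refine (min_le_right _ _).trans (ENNReal.ofReal_le_ofReal ?_)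
          rcases hy.eq_or_lt with rfl | hy
          · rw [zero_mul]; positivity
          set k := i / M
          have hk : (0 : ℝ) < k := by exact_mod_cast h
          have hki : (M : ℝ) * k ≤ i := by exact_mod_cast Nat.mul_div_le i M
          have hle : y ^ (1 / α) * k ≤ c * i := by
            calc y ^ (1 / α) * k ≤ c * M * k := by gcongr
              _ = c * (M * k) := by ring
              _ ≤ c * i := by gcongr
          have hpos : 0 < y ^ (1 / α) := by positivity
          calc y * (c * i) ^ (-α) ≤ y * (y ^ (1 / α) * k) ^ (-α) := by
                gcongr y * ?_
                exact Real.rpow_le_rpow_of_nonpos (by positivity) hle (by linarith)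
            _ = (k : ℝ) ^ (-α) := by
                rw [Real.mul_rpow hpos.le hk.le, ← Real.rpow_mul hy.le]
                have : 1 / α * -α = -1 := by field_simp
                rw [this, Real.rpow_neg_one, ← mul_assoc, mul_inv_cancel₀ hy.ne', one_mul]
    _ = M * ∑' k, powerTail α k := tsum_div_eq _
    _ ≤ (ENNReal.ofReal (c⁻¹ * y ^ (1 / α)) + 2) * ∑' k, powerTail α k := by
        gcongr
        rw [← ENNReal.ofReal_natCast, show (2 : ℝ≥0∞) = ENNReal.ofReal 2 by simp,
          ← ENNReal.ofReal_add (by positivity) (by norm_num)]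
        refine ENNReal.ofReal_le_ofReal ?_
        rw [hM]; push_cast
        linarith [Nat.ceil_lt_add_one (a := c⁻¹ * y ^ (1 / α)) (by positivity)]

end Series

/-! ### Growth of arrival times and Borel–Cantelli -/

/-- Multiplying the rate `r` density by `exp (-x)` gives `r / (r + 1)` times the rate `r + 1`
density. -/
lemma lintegral_exp_neg_expMeasure {r : ℝ} (hr : 0 < r) :
    ∫⁻ x, ENNReal.ofReal (Real.exp (-x)) ∂(expMeasure r) = ENNReal.ofReal (r / (r + 1)) := by
  have hpdf : ∀ r, Measurable (exponentialPDF r) :=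
    fun r => (measurable_exponentialPDFReal r).ennreal_ofReal
  have hexp : expMeasure r = volume.withDensity (exponentialPDF r) := rfl
  rw [hexp, lintegral_withDensity_eq_lintegral_mul _ (hpdf r) (by fun_prop)]
  have h : ∀ x, (exponentialPDF r * fun x => ENNReal.ofReal (Real.exp (-x))) x
      = ENNReal.ofReal (r / (r + 1)) * exponentialPDF (r + 1) x := fun x => by
    rw [Pi.mul_apply]
    rcases lt_or_ge x 0 with hx | hx
    · rw [exponentialPDF_of_neg hx, exponentialPDF_of_neg hx, zero_mul, mul_zero]
    · rw [exponentialPDF_of_nonneg hx, exponentialPDF_of_nonneg hx,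
        ← ENNReal.ofReal_mul (by positivity), ← ENNReal.ofReal_mul (by positivity)]
      congr 1
      rw [mul_assoc, ← Real.exp_add, ← mul_assoc, div_mul_cancel₀ _ (by positivity)]
      congr 2
      ring
  simp_rw [h]
  rw [lintegral_const_mul _ (hpdf _), lintegral_exponentialPDF_eq_one (by positivity), mul_one]

lemma measurable_comp_toNNReal {Ω : Type*} [MeasurableSpace Ω] {F : Type*} [MeasurableSpace F]
    {C : ℝ≥0 → Ω → F} (hC : Measurable fun p : ℝ≥0 × Ω => C p.1 p.2) :
    Measurable fun p : ℝ × Ω => C p.1.toNNReal p.2 :=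
  hC.comp (f := fun p : ℝ × Ω => (p.1.toNNReal, p.2)) (by fun_prop)

/-- The size of a batch. -/
noncomputable def batchSize {J : ℕ} (b : Fin J → ℕ) : ℝ := ∑ j, (b j : ℝ)

namespace IsNetwork

variable {Ω : Type*} {J : ℕ} [mΩ : MeasurableSpace Ω] {P : Measure Ω} {lam : ℝ}
  {ν : Measure (Fin J → ℕ)}
  {q : Fin J → Fin J → ℝ≥0 → ℝ} {T : ℕ → Ω → ℝ} {B : ℕ → Ω → Fin J → ℕ}
  {X : ℕ → Fin J → ℕ → ℝ≥0 → Ω → Option (Fin J)}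

lemma lintegral_exp_neg_arrival (hnet : IsNetwork P lam ν q T B X) (i : ℕ) :
    ∫⁻ ω, ENNReal.ofReal (Real.exp (-T i ω)) ∂P = ENNReal.ofReal (lam / (lam + 1)) ^ (i + 1) := by
  have hm : Measurable fun x : ℝ => ENNReal.ofReal (Real.exp (-x)) := by fun_prop
  have h := lintegral_prod_eq_prod_lintegral_of_indepFun (μ := P) (Finset.range (i + 1))
    (fun j ω => ENNReal.ofReal (Real.exp (-interarrival T j ω)))
    (hnet.iIndepFun_interarrival.comp (fun _ x => ENNReal.ofReal (Real.exp (-x))) fun _ => hm)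
    (fun j => hm.comp (hnet.measurable_interarrival j))
  have hj : ∀ j, ∫⁻ ω, ENNReal.ofReal (Real.exp (-interarrival T j ω)) ∂P
      = ENNReal.ofReal (lam / (lam + 1)) := fun j => by
    rw [← lintegral_exp_neg_expMeasure hnet.rate_pos, ← hnet.law_interarrival j,
      lintegral_map hm (hnet.measurable_interarrival j)]
  simp_rw [hj, ← ENNReal.ofReal_prod_of_nonneg fun j _ => (Real.exp_pos _).le, ← Real.exp_sum,
    Finset.sum_neg_distrib, sum_interarrival] at h
  simpa using h

/-- Arrivals occur at a positive rate, up to events of summable probability. -/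
lemma exists_tsum_arrival_le_ne_top (hnet : IsNetwork P lam ν q T B X) :
    ∃ c : ℝ, 0 < c ∧ ∑' i : ℕ, P {ω | T i ω ≤ c * i} ≠ ⊤ := by
  have hlam := hnet.rate_pos
  set ρ := lam / (lam + 1) with hρ
  have hρ0 : 0 < ρ := by positivity
  have hρ1 : ρ < 1 := by rw [hρ, div_lt_one (by positivity)]; linarith
  have hlog := Real.log_neg hρ0 hρ1
  -- With this `c`, `exp c * ρ` is the square root of `ρ`, so the Markov bounds for `exp (-T i)`
  -- form a convergent geometric series.
  refine ⟨-Real.log ρ / 2, by linarith, ?_⟩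
  set c := -Real.log ρ / 2 with hc
  have hr : Real.exp c * ρ < 1 := by
    rw [← Real.exp_log hρ0, ← Real.exp_add, Real.exp_lt_one_iff, hc]
    linarith
  have hle : ∀ i : ℕ, P {ω | T i ω ≤ c * i} ≤ ENNReal.ofReal (Real.exp c * ρ) ^ i := fun i => by
    have h1 : P {ω | T i ω ≤ c * i} ≤ P {ω | ENNReal.ofReal (Real.exp (-(c * i)))
        ≤ ENNReal.ofReal (Real.exp (-T i ω))} := by
      refine measure_mono fun ω hω => ?_
      exact ENNReal.ofReal_le_ofReal (Real.exp_le_exp.2 (neg_le_neg hω))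
    have h2 := meas_ge_le_lintegral_div (μ := P)
      (f := fun ω => ENNReal.ofReal (Real.exp (-T i ω)))
      (by have := hnet.measurable_arrival i; fun_prop)
      (ε := ENNReal.ofReal (Real.exp (-(c * i)))) (by simp [Real.exp_pos]) ENNReal.ofReal_ne_top
    refine h1.trans (h2.trans ?_)
    rw [hnet.lintegral_exp_neg_arrival, ← ENNReal.ofReal_pow hρ0.le,
      ← ENNReal.ofReal_div_of_pos (Real.exp_pos _), ← ENNReal.ofReal_pow (by positivity)]
    refine ENNReal.ofReal_le_ofReal ?_
    rw [Real.exp_neg, div_inv_eq_mul, mul_pow, ← Real.exp_nat_mul, mul_comm c, mul_comm]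
    gcongr ?_ * ?_
    exact pow_le_pow_of_le_one hρ0.le hρ1.le (Nat.le_succ i)
  refine ne_top_of_le_ne_top ?_ (ENNReal.tsum_le_tsum hle)
  rw [ENNReal.tsum_geometric]
  simp only [ne_eq, ENNReal.inv_eq_top, tsub_eq_zero_iff_le, not_le]
  simpa using hr

lemma ae_interarrival_nonneg (hnet : IsNetwork P lam ν q T B X) :
    ∀ᵐ ω ∂P, ∀ i, 0 ≤ interarrival T i ω := by
  refine ae_all_iff.2 fun i => ?_
  have h : ∀ᵐ x ∂(expMeasure lam), 0 ≤ x := by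
    have h0 : expMeasure lam (Set.Iio 0) = 0 := by
      have hexp : expMeasure lam = volume.withDensity (exponentialPDF lam) := rfl
      rw [hexp, withDensity_apply _ measurableSet_Iio]
      exact lintegral_exponentialPDF_of_nonpos le_rfl
    simp only [ae_iff, not_le]
    exact h0
  rw [← hnet.law_interarrival i] at h
  exact ae_of_ae_map (hnet.measurable_interarrival i).aemeasurable h

lemma ae_arrival_unbounded (hnet : IsNetwork P lam ν q T B X) :
    ∀ᵐ ω ∂P, ∀ t : ℝ, ∃ i, t < T i ω := by
  obtain ⟨c, hc, hsum⟩ := hnet.exists_tsum_arrival_le_ne_top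
  filter_upwards [ae_eventually_notMem hsum] with ω hω t
  have h1 : ∀ᶠ i : ℕ in atTop, t < c * i :=
    (tendsto_natCast_atTop_atTop.const_mul_atTop hc).eventually_gt_atTop t
  obtain ⟨i, hi, hti⟩ := (hω.and h1).exists
  exact ⟨i, hti.trans (not_le.1 hi)⟩

lemma measure_position_ne_none_le [IsProbabilityMeasure P] (hnet : IsNetwork P lam ν q T B X)
    (i : ℕ) (j : Fin J) (ℓ : ℕ) (s : ℝ≥0) :
    P {ω | X i j ℓ s ω ≠ none} ≤ ENNReal.ofReal (occupancyTail q j s) := by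
  have h : {ω | X i j ℓ s ω ≠ none} ⊆ ⋃ k, {ω | X i j ℓ s ω = some k} := fun ω hω =>
    Set.mem_iUnion.2 (Option.ne_none_iff_exists'.1 hω)
  have hq : ∀ k, 0 ≤ q j k s := fun k => by
    rw [← hnet.law_position i j ℓ s k]; exact measureReal_nonneg
  refine (measure_mono h).trans ((measure_iUnion_fintype_le _ _).trans ?_)
  rw [occupancyTail, ENNReal.ofReal_sum_of_nonneg fun k _ => hq k]
  refine Finset.sum_le_sum fun k _ => ?_
  rw [← hnet.law_position i j ℓ s k, ofReal_measureReal]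

/-- The probability that a batch contributes at age `s`. -/
lemma measure_contribution_ne_zero_le [IsProbabilityMeasure P]
    (hnet : IsNetwork P lam ν q T B X) (i : ℕ) (s : ℝ≥0) {r : ℝ}
    (hs : ∀ j, occupancyTail q j s ≤ r) :
    P {ω | contribution B X i s ω ≠ 0}
      ≤ ∫⁻ b, min 1 (ENNReal.ofReal (batchSize b * r)) ∂ν := by
  have hB := hnet.measurable_batch i
  rw [lintegral_countable']
  have hsub : {ω | contribution B X i s ω ≠ 0} ⊆ ⋃ b, (B i ⁻¹' {b} ∩
      ⋃ j, ⋃ ℓ ∈ Finset.range (b j), {ω | X i j ℓ s ω ≠ none}) := by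
    intro ω hω
    refine Set.mem_iUnion.2 ⟨B i ω, rfl, ?_⟩
    by_contra hcon
    simp only [Set.mem_iUnion, not_exists, Set.mem_ofPred_eq, not_not] at hcon
    refine hω (funext fun k => ?_)
    change ∑ j, ∑ ℓ ∈ Finset.range (B i ω j), positionVector (X i j ℓ s ω) k = 0
    refine Finset.sum_eq_zero fun j _ => Finset.sum_eq_zero fun ℓ hℓ => ?_
    simp [positionVector, hcon j ℓ hℓ]
  refine (measure_mono hsub).trans ((measure_iUnion_le _).trans
    (ENNReal.tsum_le_tsum fun b => ?_))
  have hν : ν {b} = P (B i ⁻¹' {b}) := by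
    rw [← hnet.law_batch i, Measure.map_apply hB (measurableSet_singleton b)]
  rw [hν, min_mul_of_nonneg _ _ zero_le, one_mul]
  -- The bound `1` drops the positions altogether; the other is a union bound over the members of a
  -- batch with value `b`, using independence of batch vector and route.
  refine le_min (measure_mono Set.inter_subset_left) ?_
  have hind : ∀ j ℓ, P (B i ⁻¹' {b} ∩ {ω | X i j ℓ s ω ≠ none})
      ≤ ENNReal.ofReal r * P (B i ⁻¹' {b}) := fun j ℓ => by
    have h := hnet.independent.indep (i := Source.batch i) (j := Source.route i j ℓ) (by simp)
    have hm : MeasurableSet[sourceSigma T B X (Source.route i j ℓ)] {ω | X i j ℓ s ω ≠ none} :=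
      le_iSup (fun s => MeasurableSpace.comap (X i j ℓ s) ⊤) s _ ⟨{x | x ≠ none}, trivial, rfl⟩
    rw [(Indep_iff _ _ P).1 h _ _ ⟨{b}, measurableSet_singleton b, rfl⟩ hm, mul_comm]
    gcongr
    exact (hnet.measure_position_ne_none_le i j ℓ s).trans (ENNReal.ofReal_le_ofReal (hs j))
  simp only [Set.inter_iUnion]
  calc _ ≤ ∑ j, ∑ ℓ ∈ Finset.range (b j), ENNReal.ofReal r * P (B i ⁻¹' {b}) := by
        refine (measure_iUnion_fintype_le _ _).trans (Finset.sum_le_sum fun j _ => ?_)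
        refine (measure_biUnion_finset_le _ _).trans (Finset.sum_le_sum fun ℓ _ => hind j ℓ)
    _ = ENNReal.ofReal (batchSize b * r) * P (B i ⁻¹' {b}) := by
        rw [batchSize, ENNReal.ofReal_mul (by positivity),
          ENNReal.ofReal_sum_of_nonneg fun j _ => by positivity]
        simp [Finset.sum_mul, mul_assoc]

/-- Almost surely only finitely many batches contribute at age `T i`. -/
lemma ae_eventually_contribution_eq_zero [IsProbabilityMeasure P]
    (hnet : IsNetwork P lam ν q T B X) {α : ℝ} (hα : 1 < α) {t₀ : ℝ≥0} (ht₀ : 0 < t₀)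
    (htail : ∀ j : Fin J, ∀ t : ℝ≥0, t₀ ≤ t → occupancyTail q j t ≤ (t : ℝ) ^ (-α))
    (hmoment : ∫⁻ s, ENNReal.ofReal ((∑ j, (s j : ℝ)) ^ (1 / α)) ∂ν < ⊤) :
    ∀ᵐ ω ∂P, ∀ᶠ i in atTop, contribution B X i (T i ω).toNNReal ω = 0 := by
  obtain ⟨c, hc, hsum⟩ := hnet.exists_tsum_arrival_le_ne_top
  have hνp : IsProbabilityMeasure ν := by
    rw [← hnet.law_batch 0]
    exact Measure.isProbabilityMeasure_map (hnet.measurable_batch 0).aemeasurable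
  -- From index `N` on, `c * i ≥ t₀`, so the tail hypothesis applies at every age above `c * i`.
  obtain ⟨N, hN⟩ := exists_nat_gt ((t₀ : ℝ) / c)
  let w : ℕ → ℝ≥0∞ := fun i =>
    ∫⁻ b, min 1 (ENNReal.ofReal (batchSize b * (c * i) ^ (-α))) ∂ν
  have hw : ∑' i, w i ≠ ⊤ := by
    rw [← lintegral_tsum fun i => (Measurable.of_discrete).aemeasurable]
    refine ne_top_of_le_ne_top ?_ (lintegral_mono fun b => tsum_min_one_rpow_le hα hc
      (Finset.sum_nonneg fun j _ => by positivity))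
    rw [lintegral_mul_const _ Measurable.of_discrete, lintegral_add_right _ measurable_const]
    refine ENNReal.mul_ne_top (ENNReal.add_ne_top.2 ⟨?_, by simp⟩) (tsum_powerTail_ne_top hα)
    simp_rw [ENNReal.ofReal_mul (inv_nonneg.2 hc.le)]
    rw [lintegral_const_mul _ Measurable.of_discrete]
    exact ENNReal.mul_ne_top ENNReal.ofReal_ne_top hmoment.ne
  have hbound : ∀ i, N ≤ i → P {ω | contribution B X i (T i ω).toNNReal ω ≠ 0}
      ≤ P {ω | T i ω ≤ c * i} + w i := fun i hi => by
    have hci : (t₀ : ℝ) ≤ c * i := by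
      rw [div_lt_iff₀ hc] at hN
      have : (N : ℝ) ≤ i := by exact_mod_cast hi
      nlinarith
    have hsub : {ω | contribution B X i (T i ω).toNNReal ω ≠ 0} ⊆ {ω | T i ω ≤ c * i} ∪
        {ω | contribution B X i (T i ω).toNNReal ω ≠ 0 ∧ c * i < T i ω} := fun ω hω =>
      (le_or_gt (T i ω) (c * i)).imp id fun h => ⟨hω, h⟩
    refine (measure_mono hsub).trans ((measure_union_le _ _).trans ?_)
    gcongr
    have hA : MeasurableSet[MeasurableSpace.prod inferInstance (dataSigma T B X)]
        {p : ℝ × Ω | contribution B X i p.1.toNNReal p.2 ≠ 0 ∧ c * i < p.1} := by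
      refine @MeasurableSet.inter _ (_) _ _ ?_ ?_
      · exact @measurable_comp_toNNReal Ω (dataSigma T B X) _ _ _
          (hnet.measurable_contribution_prod i) _ (measurableSet_singleton (0 : Fin J → ℕ)).compl
      · exact @measurable_fst _ _ _ (dataSigma T B X) _ measurableSet_Ioi
    -- The arrival time is frozen at a value `τ`; only `τ > c * i` matters, and there the bound `w
    -- i` is uniform in `τ`.
    have h := (measure_prodMk_of_indep (hnet.measurable_arrival i) rfl hnet.dataSigma_le
      (hnet.indep_dataSigma (measurable_arrival_iSup T i)) hA).2
    refine h.le.trans ?_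
    have := Measure.isProbabilityMeasure_map (μ := P) (hnet.measurable_arrival i).aemeasurable
    refine (lintegral_mono (g := fun _ => w i) fun τ => ?_).trans (by simp)
    by_cases hτ : c * i < τ
    · have hτ0 : t₀ ≤ τ.toNNReal := by
        rw [← NNReal.coe_le_coe, Real.coe_toNNReal']
        exact (hci.trans hτ.le).trans (le_max_left _ _)
      have ht₀' : (0 : ℝ) < t₀ := by exact_mod_cast ht₀
      refine (measure_mono fun ω hω => hω.1).trans
        (hnet.measure_contribution_ne_zero_le i τ.toNNReal (r := (c * i) ^ (-α))
          fun j => ?_)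
      refine (htail j _ hτ0).trans ?_
      rw [Real.coe_toNNReal _ (by linarith)]
      exact Real.rpow_le_rpow_of_nonpos (by linarith) hτ.le (by linarith)
    · simp [hτ]
  have hshift : ∑' i, P {ω | contribution B X (i + N) (T (i + N) ω).toNNReal ω ≠ 0} ≠ ⊤ := by
    refine ne_top_of_le_ne_top (ENNReal.add_ne_top.2 ⟨hsum, hw⟩)
      ((ENNReal.tsum_le_tsum fun i => hbound (i + N) (by omega)).trans ?_)
    rw [← ENNReal.tsum_add]
    exact ENNReal.tsum_comp_le_tsum_of_injective (add_left_injective N)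
      fun i => P {ω | T i ω ≤ c * i} + w i
  filter_upwards [ae_eventually_notMem hshift] with ω hω
  simp only [not_not] at hω
  rw [← map_add_atTop_eq_nat N]
  exact eventually_map.2 hω

end IsNetwork
-- The reversed occupancy and its almost sure limit
variable {Ω : Type*} {J : ℕ}

/-- The number of customers in each queue at time `t`, if batch `i` is observed at age `φ i`. -/
noncomputable def observedCount (T : ℕ → Ω → ℝ) (B : ℕ → Ω → Fin J → ℕ)
    (X : ℕ → Fin J → ℕ → ℝ≥0 → Ω → Option (Fin J)) (φ : ℕ → Ω → ℝ) (t : ℝ) (ω : Ω)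
    (k : Fin J) : ℝ≥0∞ :=
  ∑' i, if T i ω ≤ t then (contribution B X i (φ i ω).toNNReal ω k : ℝ≥0∞) else 0

lemma toENNReal_occupancy (T : ℕ → Ω → ℝ) (B : ℕ → Ω → Fin J → ℕ)
    (X : ℕ → Fin J → ℕ → ℝ≥0 → Ω → Option (Fin J)) (t : ℝ≥0) (ω : Ω) (k : Fin J) :
    (occupancy T B X t ω k : ℝ≥0∞) = observedCount T B X (fun i ω => t - T i ω) t ω k := by
  classical
  rw [occupancy, ← ENNReal.tsum_set_one, tsum_subtype _ fun _ => (1 : ℝ≥0∞), ENNReal.tsum_prod', observedCount]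
  refine tsum_congr fun i => ?_
  rw [ENNReal.tsum_prod', tsum_fintype]
  by_cases hi : T i ω ≤ t
  · rw [if_pos hi]
    have hc : contribution B X i (t - T i ω).toNNReal ω k = ∑ j, ∑ ℓ ∈ Finset.range (B i ω j),
        positionVector (X i j ℓ (t - T i ω).toNNReal ω) k := rfl
    rw [hc]
    push_cast
    refine Finset.sum_congr rfl fun j _ => ?_
    rw [tsum_eq_sum (s := Finset.range (B i ω j))]
    · refine Finset.sum_congr rfl fun ℓ hℓ => ?_
      simp [Set.indicator_apply, hi, Finset.mem_range.1 hℓ, positionVector]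
    · intro ℓ hℓ
      refine Set.indicator_of_notMem (fun h => hℓ (Finset.mem_range.2 h.2.1)) _
  · rw [if_neg hi]
    refine Finset.sum_eq_zero fun j _ => ENNReal.tsum_eq_zero.2 fun ℓ => ?_
    exact Set.indicator_of_notMem (fun h => hi h.1) _

lemma observedCount_of_mem_countEvent {T : ℕ → Ω → ℝ} (B : ℕ → Ω → Fin J → ℕ)
    (X : ℕ → Fin J → ℕ → ℝ≥0 → Ω → Option (Fin J)) (φ : ℕ → Ω → ℝ) {t : ℝ} {ω : Ω}
    (hω : ∀ i, 0 ≤ interarrival T i ω) {n : ℕ} (h : ω ∈ countEvent T t n) (a : Fin J → ℕ) :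
    (∀ k, observedCount T B X φ t ω k = a k) ↔
      ∑ i : Fin n, contribution B X i (φ i ω).toNNReal ω = a := by
  have hk : ∀ k, observedCount T B X φ t ω k
      = ((∑ i : Fin n, contribution B X i (φ i ω).toNNReal ω) k : ℕ) := fun k => by
    simp only [observedCount, arrival_le_iff_of_mem_countEvent hω h]
    rw [tsum_eq_sum (s := Finset.range n) (fun i hi => if_neg (by simpa using hi)),
      Finset.sum_apply, Fin.sum_univ_eq_sum_range
        (fun i => contribution B X i (φ i ω).toNNReal ω k)]
    push_cast
    exact Finset.sum_congr rfl fun i hi => if_pos (Finset.mem_range.1 hi)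
  simp only [hk, Nat.cast_inj, funext_iff]

namespace IsNetwork

variable [mΩ : MeasurableSpace Ω] {P : Measure Ω} {lam : ℝ} {ν : Measure (Fin J → ℕ)}
  {q : Fin J → Fin J → ℝ≥0 → ℝ} {T : ℕ → Ω → ℝ} {B : ℕ → Ω → Fin J → ℕ}
  {X : ℕ → Fin J → ℕ → ℝ≥0 → Ω → Option (Fin J)}

/-- The occupancy vector at time `t` has the law of the vector obtained by observing each batch
`i` that arrives before `t` at age `T i`. -/
lemma measure_occupancy_eq [IsProbabilityMeasure P] (hnet : IsNetwork P lam ν q T B X) (t : ℝ≥0)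
    (a : Fin J → ℕ) :
    P {ω | ∀ k, occupancy T B X t ω k = a k} = P {ω | ∀ k, observedCount T B X T t ω k = a k} := by
  have hocc : {ω | ∀ k, occupancy T B X t ω k = a k}
      = {ω | ∀ k, observedCount T B X (fun i ω => t - T i ω) t ω k = a k} := by
    ext ω
    simp only [Set.mem_ofPred_eq, ← toENNReal_occupancy]
    refine forall_congr' fun k => ?_
    rw [← ENat.toENNReal_inj, ENat.toENNReal_coe]
  rw [hocc]
  refine measure_eq_of_forall_inter_eq (E := countEvent T t)
    (hnet.measurableSet_countEvent t) (disjoint_countEvent T t) ?_ fun n => ?_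
  · filter_upwards [hnet.ae_interarrival_nonneg, hnet.ae_arrival_unbounded] with ω h1 h2
    exact exists_mem_countEvent t.coe_nonneg h1 (h2 t)
  have key : ∀ φ : ℕ → Ω → ℝ,
      P ({ω | ∀ k, observedCount T B X φ t ω k = a k} ∩ countEvent T t n)
        = P ({ω | ∑ i : Fin n, contribution B X i (φ i ω).toNNReal ω = a}
          ∩ countEvent T t n) := fun φ => by
    refine measure_congr ?_
    filter_upwards [hnet.ae_interarrival_nonneg] with ω hω
    refine propext (and_congr_left fun h => ?_)
    exact observedCount_of_mem_countEvent B X φ hω h a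
  rw [key, key]
  exact hnet.measure_sum_contribution_reverse t n a

lemma measurable_contribution_arrival (hnet : IsNetwork P lam ν q T B X) (i : ℕ) :
    Measurable fun ω => contribution B X i (T i ω).toNNReal ω := by
  have h : Measurable fun p : ℝ≥0 × Ω => contribution B X i p.1 p.2 :=
    (hnet.measurable_contribution_prod i).mono
      (sup_le_sup le_rfl (MeasurableSpace.comap_mono hnet.dataSigma_le)) le_rfl
  have hT := hnet.measurable_arrival i
  exact h.comp (f := fun ω => ((T i ω).toNNReal, ω)) (by fun_prop)

/-- If customers leave the network at a polynomial rate `α > 1` and batch sizes have a finite moment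
of order `1 / α`, then the network is ergodic. -/
theorem isErgodic [IsProbabilityMeasure P] (hnet : IsNetwork P lam ν q T B X)
    {α : ℝ} (hα : 1 < α) {t₀ : ℝ≥0} (ht₀ : 0 < t₀)
    (htail : ∀ j : Fin J, ∀ t : ℝ≥0, t₀ ≤ t → occupancyTail q j t ≤ (t : ℝ) ^ (-α))
    (hmoment : ∫⁻ s, ENNReal.ofReal ((∑ j, (s j : ℝ)) ^ (1 / α)) ∂ν < ⊤) :
    IsErgodic P T B X := by
  have hmC := fun i (k : Fin J) =>
    (measurable_pi_apply k).comp (hnet.measurable_contribution_arrival i)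
  have hmC' : ∀ i k, Measurable fun ω =>
      (contribution B X i (T i ω).toNNReal ω k : ℝ≥0∞) :=
    fun i k => (Measurable.of_discrete (f := fun n : ℕ => (n : ℝ≥0∞))).comp (hmC i k)
  let L : Ω → Fin J → ℝ≥0∞ := fun ω k => ∑' i, (contribution B X i (T i ω).toNNReal ω k : ℝ≥0∞)
  have hmL : ∀ k, Measurable fun ω => L ω k := fun k => Measurable.tsum fun i => hmC' i k
  have hmO : ∀ (t : ℝ≥0) k, Measurable fun ω => observedCount T B X T t ω k := fun t k =>
    Measurable.tsum fun i => Measurable.ite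
      (measurableSet_le (hnet.measurable_arrival i) measurable_const) (hmC' i k) measurable_const
  have hmE : ∀ a : Fin J → ℕ, MeasurableSet {ω | ∀ k, L ω k = a k} := fun a => by
    rw [Set.ofPred_forall]
    exact MeasurableSet.iInter fun k => measurableSet_eq_fun (hmL k) measurable_const
  have hfin := hnet.ae_eventually_contribution_eq_zero hα ht₀ htail hmoment
  -- The limit law is proper because `L` is almost surely a finite sum of contributions, hence a
  -- vector of natural numbers.
  have hsum : ∑' a : Fin J → ℕ, P {ω | ∀ k, L ω k = a k} = 1 := by
    rw [← measure_iUnion (fun a b hab => Set.disjoint_left.2 fun ω ha hb => hab (funext fun k =>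
      Nat.cast_injective (R := ℝ≥0∞) ((ha k).symm.trans (hb k)))) hmE,
      ← measure_univ (μ := P)]
    refine measure_congr (eventuallyEq_univ.2 ?_)
    filter_upwards [hfin] with ω hω
    obtain ⟨N, hN⟩ := eventually_atTop.1 hω
    refine Set.mem_iUnion.2
      ⟨fun k => ∑ i ∈ Finset.range N, contribution B X i (T i ω).toNNReal ω k, fun k => ?_⟩
    push_cast
    refine tsum_eq_sum fun i hi => ?_
    simp [hN i (by simpa using hi)]
  refine ⟨⟨fun a => P {ω | ∀ k, L ω k = a k}, hsum ▸ ENNReal.summable.hasSum⟩, fun a => ?_⟩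
  simp_rw [hnet.measure_occupancy_eq]
  refine tendsto_measure_of_ae_tendsto_indicator_of_isFiniteMeasure atTop (hmE a)
    (fun t => ?_) ?_
  · rw [Set.ofPred_forall]
    exact MeasurableSet.iInter fun k => measurableSet_eq_fun (hmO t k) measurable_const
  filter_upwards [hfin] with ω hω
  obtain ⟨N, hN⟩ := eventually_atTop.1 hω
  -- This sum dominates each of the first `N` arrival times. Beyond it all batches that can
  -- contribute have arrived, so the reversed count equals `L` and the indicators are constant.
  filter_upwards [eventually_ge_atTop (∑ i ∈ Finset.range N, (T i ω).toNNReal)] with t ht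
  have hOL : ∀ k, observedCount T B X T t ω k = L ω k := fun k => by
    refine tsum_congr fun i => ?_
    rcases lt_or_ge i N with hi | hi
    · refine if_pos ((Real.le_coe_toNNReal _).trans (NNReal.coe_le_coe.2 (le_trans ?_ ht)))
      exact Finset.single_le_sum (f := fun i => (T i ω).toNNReal) (fun _ _ => zero_le)
        (Finset.mem_range.2 hi)
    · simp [hN i hi]
  simp [hOL]

end IsNetwork

end BatchQueue

theorem corollary4p5 {Ω : Type*} [MeasurableSpace Ω] (P : Measure Ω) [IsProbabilityMeasure P]
    (J : ℕ) (lam : ℝ) (ν : Measure (Fin J → ℕ)) (q : Fin J → Fin J → ℝ≥0 → ℝ)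
    (T : ℕ → Ω → ℝ) (B : ℕ → Ω → Fin J → ℕ)
    (X : ℕ → Fin J → ℕ → ℝ≥0 → Ω → Option (Fin J))
    (hnet : BatchQueue.IsNetwork P lam ν q T B X)
    (α : ℝ) (hα : 1 < α) (t₀ : ℝ≥0) (ht₀ : 0 < t₀)
    (htail : ∀ j : Fin J, ∀ t : ℝ≥0, t₀ ≤ t → BatchQueue.occupancyTail q j t ≤ (t : ℝ) ^ (-α))
    (hmoment : ∫⁻ s, ENNReal.ofReal ((∑ j, (s j : ℝ)) ^ (1 / α)) ∂ν < ⊤) :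
    BatchQueue.IsErgodic P T B X :=
  hnet.isErgodic hα ht₀ htail hmoment
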